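/- Let $\mathcal{A}$ be a semi-abelian category, that is, a pointed, Barr exact and Bourn protomodular category with binary coproducts, and let $\mathcal{B}$ be a Birkhoff subcategory of $\mathcal{A}$, that is, a full reflective subcategory closed under subobjects and regular quotients, with reflector $I\colon \mathcal{A}\to\mathcal{B}$ and unit $\eta$. An extension is a regular epimorphism $f\colon B\to A$ in $\mathcal{A}$; it is $\mathcal{B}$-trivial if the square $I(f)\circ\eta_B=\eta_A\circ f$ is a pullback, and $\mathcal{B}$-central if there is an extension $g\colon E\to A$ such that the pullback $g^*(f)\colon B\times_A E\to E$ of $f$ along $g$ is $\mathcal{B}$-trivial. An object $X$ is $\mathcal{B}$-perfect if $I(X)$ is a zero object. A universal $\mathcal{B}$-central extension of $A$ is a $\mathcal{B}$-central extension $u\colon U\to A$ such that for every $\mathcal{B}$-central extension $f\colon B\to A$ there is a unique $h\colon U\to B$ with $f\circ h=u$. Let $\mathsf{Ab}(\mathcal{A})$ be the full subcategory of $\mathcal{A}$ consisting of all objects that admit an internal abelian group structure. Then $\mathsf{Ab}(\mathcal{A})$ is reflective in $\mathcal{A}$ (so that $\mathsf{Ab}(\mathcal{A})$-centrality, defined as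 above with $\mathsf{Ab}(\mathcal{A})$ in place of $\mathcal{B}$, makes sense), and every $\mathcal{B}$-central extension $f\colon B\to A$ whose domain $B$ is $\mathcal{B}$-perfect is $\mathsf{Ab}(\mathcal{A})$-central. In particular, every universal $\mathcal{B}$-central extension is $\mathsf{Ab}(\mathcal{A})$-central. -/

import Mathlib

open CategoryTheory CategoryTheory.Limits

universe v u

namespace SemiAb

/-- A Barr exact category: a regular category in which every internal equivalence relation is
effective, that is, is the kernel pair of some morphism. -/
class BarrExact (C : Type u) [Category.{v} C] : Prop extends Regular C where
  exists_isKernelPair : ∀ {R X : C} (p₁ p₂ : R ⟶ X), IsEquivalenceRelation p₁ p₂ →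
    ∃ (Y : C) (q : X ⟶ Y), IsKernelPair q p₁ p₂

/-- A semi-abelian category: pointed, Barr exact, with binary coproducts, and Bourn protomodular.
For a pointed regular category, protomodularity is expressed by the (Regular) Short Five Lemma:
in a commutative square `f' ≫ a = b ≫ f` between regular epimorphisms `f'` and `f`, if `a` and the
induced morphism `Ker f' ⟶ Ker f` are isomorphisms, then so is `b`. -/
class SemiAbelian (C : Type u) [Category.{v} C] [HasZeroMorphisms C] : Prop
    extends BarrExact C where
  hasZeroObject : HasZeroObject C
  hasBinaryCoproducts : HasBinaryCoproducts C
  short_five : ∀ {B' A' B A : C} (f' : B' ⟶ A') (f : B ⟶ A) (b : B' ⟶ B) (a : A' ⟶ A)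
    (w : f' ≫ a = b ≫ f), IsRegularEpi f' → IsRegularEpi f →
    IsIso (kernel.map f' f b a w) → IsIso a → IsIso b

attribute [instance] SemiAbelian.hasZeroObject SemiAbelian.hasBinaryCoproducts

section

variable {C : Type u} [Category.{v} C]

/-- A Birkhoff subcategory, given by its class `P` of objects: a full reflective subcategory closed
under subobjects and regular quotients. -/
class IsBirkhoff (P : ObjectProperty C) [Reflective P.ι] : Prop
    extends P.IsClosedUnderSubobjects where
  prop_of_isRegularEpi : ∀ {X Y : C} (f : X ⟶ Y), IsRegularEpi f → P X → P Y

/-- The unit `η_A : A ⟶ I(A)` of the reflection of `C` onto the full subcategory `P`. -/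
noncomputable def reflectionUnit (P : ObjectProperty C) [Reflective P.ι] (A : C) :
    A ⟶ P.ι.obj ((reflector P.ι).obj A) :=
  (reflectorAdjunction P.ι).unit.app A

/-- An extension is a regular epimorphism. It is trivial with respect to `P` if its naturality
square for the unit of the reflection is a pullback. -/
def IsTrivialExtension (P : ObjectProperty C) [Reflective P.ι] {B A : C} (f : B ⟶ A) : Prop :=
  IsRegularEpi f ∧
    IsPullback f (reflectionUnit P B) (reflectionUnit P A) (P.ι.map ((reflector P.ι).map f))

/-- An extension `f : B ⟶ A` is central with respect to `P` if there is an extension `g : E ⟶ A`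
such that the pullback `g^*(f) : B ×_A E ⟶ E` of `f` along `g` is a trivial extension. -/
def IsCentralExtension (P : ObjectProperty C) [Reflective P.ι] [HasPullbacks C] {B A : C}
    (f : B ⟶ A) : Prop :=
  IsRegularEpi f ∧
    ∃ (E : C) (g : E ⟶ A), IsRegularEpi g ∧ IsTrivialExtension P (pullback.snd f g)

/-- An object is perfect with respect to `P` if its reflection is the zero object of the
subcategory. -/
def IsPerfect (P : ObjectProperty C) [Reflective P.ι] (X : C) : Prop :=
  IsZero ((reflector P.ι).obj X)

/-- A universal central extension of `A`: an initial object of the full subcategory of the slice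
category over `A` formed by the central extensions of `A`. -/
def IsUniversalCentralExtension (P : ObjectProperty C) [Reflective P.ι] [HasPullbacks C]
    {U A : C} (u : U ⟶ A) : Prop :=
  IsCentralExtension P u ∧
    ∀ (B : C) (f : B ⟶ A), IsCentralExtension P f → ∃! h : U ⟶ B, h ≫ f = u

/-- `Ab(C)`: the objects that admit an internal abelian group structure (with respect to the
finite products of `C`). -/
def abelianObjects (C : Type u) [Category.{v} C] [HasFiniteProducts C] : ObjectProperty C :=
  fun X =>
    letI : CartesianMonoidalCategory C := CartesianMonoidalCategory.ofHasFiniteProducts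
    letI : BraidedCategory C := BraidedCategory.ofCartesianMonoidalCategory
    ∃ _ : GrpObj X, IsCommMonObj X

end

end SemiAb

/-! Let `f : B ⟶ A` be central with kernel `K` and `B` perfect, and let `p : Q ⟶ E` be a trivial
pullback of `f`, with `q : Q ⟶ B`. Triviality makes `Q` the pullback of `E` and `I(Q)` over `I(E)`,
so `Ker η_Q` and `K` commute inside `Q`: there is `σ : Ker η_Q × K ⟶ Q` extending both inclusions. A
common regular quotient of `B` and `I(Q)` lies in `P` and is a quotient of a perfect object, hence
zero; therefore `Ker η_Q ⟶ B` is a regular epimorphism (`isRegularEpi_kernel_comp`). Descending `σ ≫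
q` along it gives `φ : B × K ⟶ B` with `φ(b, 0) = b` and `φ(0, x) = x`
(`exists_cooperator_of_isCentralExtension`). Then `K` is abelian and `(φ, fst) : B × K ⟶ B ×_A B` is
an isomorphism, so `f` pulled back along itself is a product projection with abelian kernel, which
is trivial for `Ab(C)` (`isCentralExtension_of_cooperator`). Abelian objects are those with a unital
multiplication; coequalizing the two injections `X ⟶ X × X` reflects onto them. -/

namespace SemiAb

open MonoidalCategory CartesianMonoidalCategory

/-! ### Split short five lemma, regular epimorphisms and images. -/

section Protomodular

variable {C : Type u} [Category.{v} C] [HasZeroMorphisms C] [SemiAbelian C]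

/-- The split short five lemma, for a comparison with target a split epimorphism `p`. -/
lemma isIso_of_kernel_lift {V' V D : C} (p : V ⟶ D) (b : V' ⟶ V) [IsSplitEpi (b ≫ p)]
    (hmono : ∀ {T : C} (s t : T ⟶ V'), s ≫ b ≫ p = 0 → t ≫ b ≫ p = 0 → s ≫ b = t ≫ b → s = t)
    (hlift : ∀ {T : C} (t : T ⟶ V), t ≫ p = 0 → ∃ t' : T ⟶ V', t' ≫ b = t) : IsIso b := by
  have : IsSplitEpi p := ⟨⟨section_ (b ≫ p) ≫ b, by simp⟩⟩
  have w : (b ≫ p) ≫ 𝟙 D = b ≫ p := Category.comp_id _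
  refine SemiAbelian.short_five (b ≫ p) p b (𝟙 D) w inferInstance inferInstance ?_ inferInstance
  obtain ⟨t, ht⟩ := hlift (kernel.ι p) (kernel.condition p)
  have ht' : t ≫ b ≫ p = 0 := by rw [reassoc_of% ht, kernel.condition]
  refine ⟨kernel.lift _ t ht', ?_, ?_⟩
  · rw [← cancel_mono (kernel.ι _)]
    refine hmono _ _ (by simp [ht']) (by simp) ?_
    simp [ht]
  · rw [← cancel_mono (kernel.ι _)]
    simp [ht]

/-- A subobject of the domain of a split epimorphism `p` that contains a section and the kernel of
`p` is everything. -/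
lemma isIso_of_mono_of_section {M V D : C} (p : V ⟶ D) (m : M ⟶ V) [Mono m] (i : D ⟶ M)
    (hi : i ≫ m ≫ p = 𝟙 D)
    (hlift : ∀ {T : C} (t : T ⟶ V), t ≫ p = 0 → ∃ t' : T ⟶ M, t' ≫ m = t) : IsIso m := by
  have : IsSplitEpi (m ≫ p) := ⟨⟨i, hi⟩⟩
  exact isIso_of_kernel_lift p m (fun s t _ _ h => (cancel_mono m).1 h) hlift

lemma isRegularEpi_comp {X Y Z : C} (f : X ⟶ Y) (g : Y ⟶ Z) [IsRegularEpi f] [IsRegularEpi g] :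
    IsRegularEpi (f ≫ g) := by
  have : StrongEpi (f ≫ g) := strongEpi_comp f g
  infer_instance

lemma isRegularEpi_of_comp {X Y Z : C} (f : X ⟶ Y) (g : Y ⟶ Z) [IsRegularEpi (f ≫ g)] :
    IsRegularEpi g := by
  have : StrongEpi g := strongEpi_of_strongEpi f g
  infer_instance

lemma isRegularEpi_of_isPullback {P X Y Z : C} {fst : P ⟶ X} {snd : P ⟶ Y} {f : X ⟶ Z} {g : Y ⟶ Z}
    (h : IsPullback fst snd f g) [IsRegularEpi g] : IsRegularEpi fst :=
  Regular.regularEpiIsStableUnderBaseChange.of_isPullback h.flip ‹_›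

lemma isPullback_of_exists {D : Type*} [Category* D] {P X Y Z : D} {fst : P ⟶ X} {snd : P ⟶ Y}
    {f : X ⟶ Z} {g : Y ⟶ Z} (w : fst ≫ f = snd ≫ g)
    (hex : ∀ {T : D} (x : T ⟶ X) (y : T ⟶ Y), x ≫ f = y ≫ g →
      ∃ l : T ⟶ P, l ≫ fst = x ∧ l ≫ snd = y)
    (huniq : ∀ {T : D} (s t : T ⟶ P), s ≫ fst = t ≫ fst → s ≫ snd = t ≫ snd → s = t) :
    IsPullback fst snd f g := by
  refine ⟨⟨w⟩, ⟨PullbackCone.IsLimit.mk w (fun s => (hex s.fst s.snd s.condition).choose)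
    (fun s => (hex s.fst s.snd s.condition).choose_spec.1)
    (fun s => (hex s.fst s.snd s.condition).choose_spec.2) fun s m h₁ h₂ => huniq _ _ ?_ ?_⟩⟩
  · rw [h₁, (hex s.fst s.snd s.condition).choose_spec.1]
  · rw [h₂, (hex s.fst s.snd s.condition).choose_spec.2]

lemma exists_image {X Y : C} (f : X ⟶ Y) :
    ∃ (I : C) (e : X ⟶ I) (m : I ⟶ Y), IsRegularEpi e ∧ Mono m ∧ e ≫ m = f :=
  ⟨_, (Regular.strongEpiMonoFactorisation f).e, (Regular.strongEpiMonoFactorisation f).m,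
    inferInstance, inferInstance, (Regular.strongEpiMonoFactorisation f).fac⟩

end Protomodular

/-! ### Elementary identities in finite products. -/

section Lift

variable {C : Type u} [Category.{v} C] [CartesianMonoidalCategory C]

lemma mono_lift_of_jointlyMono {R X Y : C} (r₁ : R ⟶ X) (r₂ : R ⟶ Y) [h : JointlyMono₂ r₁ r₂] :
    Mono (lift r₁ r₂) :=
  ⟨fun s t e => h.right_cancellation s t (by simpa using e =≫ fst _ _)
    (by simpa using e =≫ snd _ _)⟩

lemma isPullback_whiskerRight {A A' : C} (q : A ⟶ A') (M : C) :
    IsPullback (q ▷ M) (fst A M) (fst A' M) q := by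
  refine isPullback_of_exists (by simp) (fun x y h => ⟨lift y (x ≫ snd _ _), ?_, ?_⟩)
    fun x y h₁ h₂ => ?_
  · ext <;> simp [h]
  · simp
  · ext
    · exact h₂
    · simpa using h₁ =≫ snd _ _

variable [HasZeroMorphisms C]

lemma lift_zero_right_comp {T M Z : C} (x : T ⟶ M) {X : C} (μ : M ⊗ X ⟶ Z) :
    lift x 0 ≫ μ = x ≫ lift (𝟙 M) 0 ≫ μ := by
  rw [← Category.assoc]
  congr 1
  ext <;> simp

lemma lift_zero_left_comp {T M Z : C} (x : T ⟶ M) {X : C} (μ : X ⊗ M ⟶ Z) :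
    lift 0 x ≫ μ = x ≫ lift 0 (𝟙 M) ≫ μ := by
  rw [← Category.assoc]
  congr 1
  ext <;> simp

end Lift

/-! ### Morphisms out of a product are determined on its axes. -/

section Unital

variable {C : Type u} [Category.{v} C] [HasZeroMorphisms C] [SemiAbelian C]
  [CartesianMonoidalCategory C]

lemma isIso_of_mono_of_prod {M X Y : C} (m : M ⟶ X ⊗ Y) [Mono m] (i : X ⟶ M) (j : Y ⟶ M)
    (hi : i ≫ m = lift (𝟙 X) 0) (hj : j ≫ m = lift 0 (𝟙 Y)) : IsIso m := by
  refine isIso_of_mono_of_section (fst X Y) m i (by simp [reassoc_of% hi]) fun t ht =>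
    ⟨t ≫ snd X Y ≫ j, ?_⟩
  ext <;> simp [hj, ht]

/-- The equalizer is a subobject of the product containing both axes, hence everything. -/
lemma prod_hom_ext {X Y Z : C} {f g : X ⊗ Y ⟶ Z} (h₁ : lift (𝟙 X) 0 ≫ f = lift (𝟙 X) 0 ≫ g)
    (h₂ : lift 0 (𝟙 Y) ≫ f = lift 0 (𝟙 Y) ≫ g) : f = g := by
  have := isIso_of_mono_of_prod (equalizer.ι f g) (equalizer.lift _ h₁) (equalizer.lift _ h₂)
    (equalizer.lift_ι _ _) (equalizer.lift_ι _ _)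
  rw [← cancel_epi (equalizer.ι f g), equalizer.condition]

/-- Factoring through a monomorphism can be tested on the two injections of a product. -/
lemma exists_factor_of_prod {X Y Z W : C} (φ : X ⊗ Y ⟶ Z) (m : W ⟶ Z) [Mono m] (i : X ⟶ W)
    (j : Y ⟶ W) (hi : i ≫ m = lift (𝟙 X) 0 ≫ φ) (hj : j ≫ m = lift 0 (𝟙 Y) ≫ φ) :
    ∃ ψ : X ⊗ Y ⟶ W, ψ ≫ m = φ := by
  have := isIso_of_mono_of_prod (pullback.fst φ m) (pullback.lift _ _ hi.symm)
    (pullback.lift _ _ hj.symm) (pullback.lift_fst _ _ _) (pullback.lift_fst _ _ _)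
  exact ⟨inv (pullback.fst φ m) ≫ pullback.snd φ m, by simp [← pullback.condition]⟩

instance isRegularEpi_whiskerRight {A A' : C} (q : A ⟶ A') [IsRegularEpi q] (M : C) :
    IsRegularEpi (q ▷ M) :=
  isRegularEpi_of_isPullback (isPullback_whiskerRight q M)

/-- A morphism defined on a product descends along a regular epimorphism in the first variable as
soon as its restriction to the first factor does. -/
lemma exists_descent {A A' M Z : C} (q : A ⟶ A') [IsRegularEpi q] (φ : A ⊗ M ⟶ Z) (u : A' ⟶ Z)
    (hu : q ≫ u = lift (𝟙 A) 0 ≫ φ) :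
    ∃ ψ : A' ⊗ M ⟶ Z, q ▷ M ≫ ψ = φ ∧ lift (𝟙 A') 0 ≫ ψ = u ∧
      lift 0 (𝟙 M) ≫ ψ = lift 0 (𝟙 M) ≫ φ := by
  have : IsRegularEpi (q ▷ M) := inferInstance
  have hk : IsKernelPair (q ▷ M) (pullback.fst q q ▷ M) (pullback.snd q q ▷ M) := by
    refine isPullback_of_exists (by simp [← comp_whiskerRight, pullback.condition])
      (fun x y h => ?_) fun x y h₁ h₂ => ?_
    · have e₁ := h =≫ fst _ _
      have e₂ := h =≫ snd _ _
      simp only [Category.assoc, whiskerRight_fst, whiskerRight_snd] at e₁ e₂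
      refine ⟨lift (pullback.lift (x ≫ fst _ _) (y ≫ fst _ _) (by simpa using e₁))
        (x ≫ snd _ _), ?_, ?_⟩ <;> ext <;>
        simp [e₂, pullback.lift_fst, pullback.lift_snd]
    · ext
      · simpa using h₁ =≫ fst _ _
      · simpa using h₂ =≫ fst _ _
      · simpa using h₁ =≫ snd _ _
  have hepi : Epi q := (IsRegularEpi.getStruct q).epi
  have hl : lift (𝟙 A) 0 ≫ q ▷ M = q ≫ lift (𝟙 A') 0 := by ext <;> simp
  have hr : lift 0 (𝟙 M) ≫ q ▷ M = lift 0 (𝟙 M) := by ext <;> simp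
  suffices h : ∃ ψ, q ▷ M ≫ ψ = φ by
    obtain ⟨ψ, rfl⟩ := h
    exact ⟨ψ, rfl, by rw [← cancel_epi q, hu, reassoc_of% hl], by rw [reassoc_of% hr]⟩
  -- The kernel pair is again a product, so compatibility of `φ` with it is checked on the axes;
  -- only the first one uses `hu`.
  refine IsRegularEpi.exists_of_isKernelPair _ hk φ (prod_hom_ext ?_ ?_)
  · have h (s : pullback q q ⟶ A) :
        lift (𝟙 _) 0 ≫ s ▷ M ≫ φ = s ≫ q ≫ u := by
      rw [hu, ← Category.assoc, ← Category.assoc]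
      congr 1
      ext <;> simp
    rw [h, h, pullback.condition_assoc]
  · simp [← Category.assoc]

end Unital

/-! ### Mal'tsev property and coequalizers. -/

section Relations

variable {C : Type u} [Category.{v} C] [HasZeroMorphisms C] [SemiAbelian C]
  [CartesianMonoidalCategory C]

/-- Every relation in a semi-abelian category is difunctional. -/
lemma difunctional {R X Y : C} (r₁ : R ⟶ X) (r₂ : R ⟶ Y) [JointlyMono₂ r₁ r₂] {T : C}
    (x y z : T ⟶ R) (hxy : x ≫ r₂ = y ≫ r₂) (hyz : y ≫ r₁ = z ≫ r₁) :
    ∃ w : T ⟶ R, w ≫ r₁ = x ≫ r₁ ∧ w ≫ r₂ = z ≫ r₂ := by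
  have := mono_lift_of_jointlyMono r₁ r₂
  let π₁ := pullback.fst r₂ r₂
  let π₂ := pullback.snd r₂ r₂
  let ρ₁ := pullback.fst r₁ r₁
  let ρ₂ := pullback.snd r₁ r₁
  have hπ : π₁ ≫ r₂ = π₂ ≫ r₂ := pullback.condition
  have hρ : ρ₁ ≫ r₁ = ρ₂ ≫ r₁ := pullback.condition
  let v₁ := pullback.fst π₂ ρ₁
  let v₂ := pullback.snd π₂ ρ₁
  have hv : v₁ ≫ π₂ = v₂ ≫ ρ₁ := pullback.condition
  -- On chains `(x, y, z)`, `g` is the pair `(x r₁, z r₂)`, and `m` is the subobject of chains whose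
  -- pair lies in `R`. It contains the chains `(x, y, y)`, a section of `v₁`, and the chains `(0, 0,
  -- z)`, the kernel of `v₁`.
  let g := lift (v₁ ≫ π₁ ≫ r₁) (v₂ ≫ ρ₂ ≫ r₂)
  let m := pullback.fst g (lift r₁ r₂)
  let d := pullback.lift (f := r₁) (g := r₁) (𝟙 R) (𝟙 R) rfl
  have hd₁ : d ≫ ρ₁ = 𝟙 R := pullback.lift_fst _ _ _
  have hd₂ : d ≫ ρ₂ = 𝟙 R := pullback.lift_snd _ _ _
  let i₀ := pullback.lift (f := π₂) (g := ρ₁) (𝟙 _) (π₂ ≫ d) (by simp [hd₁])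
  have hi₁ : i₀ ≫ v₁ = 𝟙 _ := pullback.lift_fst _ _ _
  have hi₂ : i₀ ≫ v₂ = π₂ ≫ d := pullback.lift_snd _ _ _
  have hi : i₀ ≫ g = π₁ ≫ lift r₁ r₂ := by
    ext
    · simp [g, reassoc_of% hi₁]
    · simp [g, reassoc_of% hi₂, reassoc_of% hd₂, hπ]
  let i := pullback.lift i₀ π₁ hi
  have him : i ≫ m = i₀ := pullback.lift_fst _ _ _
  have : IsIso m := by
    refine isIso_of_mono_of_section v₁ m i (by rw [reassoc_of% him, hi₁]) fun t ht => ?_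
    have h : t ≫ g = (t ≫ v₂ ≫ ρ₂) ≫ lift r₁ r₂ := by
      ext
      · simp [g, reassoc_of% ht, ← hρ, ← reassoc_of% hv]
      · simp [g]
    exact ⟨pullback.lift t _ h, pullback.lift_fst _ _ _⟩
  let l₁ := pullback.lift x y hxy
  let l₂ := pullback.lift y z hyz
  have e₁ : l₁ ≫ π₁ = x := pullback.lift_fst _ _ _
  have e₂ : l₁ ≫ π₂ = y := pullback.lift_snd _ _ _
  have e₃ : l₂ ≫ ρ₁ = y := pullback.lift_fst _ _ _
  have e₄ : l₂ ≫ ρ₂ = z := pullback.lift_snd _ _ _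
  let l := pullback.lift l₁ l₂ (e₂.trans e₃.symm)
  have f₁ : l ≫ v₁ = l₁ := pullback.lift_fst _ _ _
  have f₂ : l ≫ v₂ = l₂ := pullback.lift_snd _ _ _
  have hm : inv m ≫ pullback.snd g (lift r₁ r₂) ≫ lift r₁ r₂ = g := by
    rw [← pullback.condition, IsIso.inv_hom_id_assoc]
  refine ⟨l ≫ inv m ≫ pullback.snd g (lift r₁ r₂), ?_, ?_⟩
  · have := (l ≫= hm) =≫ fst _ _
    simpa [g, reassoc_of% f₁, reassoc_of% e₁] using this
  · have := (l ≫= hm) =≫ snd _ _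
    simpa [g, reassoc_of% f₂, reassoc_of% e₄] using this

/-- Semi-abelian categories are Mal'tsev: reflexive relations are equivalence relations. -/
lemma isEquivalenceRelation_of_reflexive {R X : C} {p₁ p₂ : R ⟶ X} (h : ReflexiveRelation p₁ p₂) :
    IsEquivalenceRelation p₁ p₂ := by
  have := h.toJointlyMono₂
  -- Symmetry comes from the chain `(b,b), (a,b), (a,a)`, transitivity from `(a,b), (b,b), (b,c)`.
  obtain ⟨s, hs₁, hs₂⟩ := difunctional p₁ p₂ (p₂ ≫ h.r) (𝟙 R) (p₁ ≫ h.r) (by simp) (by simp)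
  obtain ⟨t, ht₁, ht₂⟩ := difunctional p₁ p₂ (pullback.fst p₂ p₁)
    (pullback.fst p₂ p₁ ≫ p₂ ≫ h.r) (pullback.snd p₂ p₁) (by simp) (by simp [pullback.condition])
  exact ⟨⟨{ h with
    s := s
    symmetry₁ := by simpa using hs₁
    symmetry₂ := by simpa using hs₂
    c := _
    isLimit := pullbackIsPullback p₂ p₁
    t := t
    transitivity₁ := ht₁
    transitivity₂ := ht₂ }⟩⟩

/-- A reflexive pair has a coequalizer, whose kernel pair is covered by the pair. -/
lemma exists_coequalizer_of_reflexive {T X : C} (a b : T ⟶ X) (r : X ⟶ T) (ha : r ≫ a = 𝟙 X)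
    (hb : r ≫ b = 𝟙 X) : ∃ (W : C) (c : X ⟶ W) (R : C) (p₁ p₂ : R ⟶ X) (e : T ⟶ R),
      IsRegularEpi c ∧ IsKernelPair c p₁ p₂ ∧ IsRegularEpi e ∧ e ≫ p₁ = a ∧ e ≫ p₂ = b := by
  obtain ⟨R, e, m, he, hm, hem⟩ := exists_image (lift a b)
  have h₁ : e ≫ m ≫ fst _ _ = a := by rw [reassoc_of% hem, lift_fst]
  have h₂ : e ≫ m ≫ snd _ _ = b := by rw [reassoc_of% hem, lift_snd]
  have hR : ReflexiveRelation (m ≫ fst X X) (m ≫ snd X X) :=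
    { right_cancellation := fun Y s t h h' => by
        rw [← cancel_mono m]
        ext
        · simpa using h
        · simpa using h'
      r := r ≫ e
      reflexivity₁ := by rw [Category.assoc, h₁, ha]
      reflexivity₂ := by rw [Category.assoc, h₂, hb] }
  obtain ⟨Y, q, hq⟩ := BarrExact.exists_isKernelPair _ _ (isEquivalenceRelation_of_reflexive hR)
  obtain ⟨W, c, n, hc, hn, rfl⟩ := exists_image q
  exact ⟨W, c, R, _, _, e, hc, hq.cancel_right_of_mono, he, h₁, h₂⟩

/-- Adjoining a copy of `X` by the coproduct makes the pair reflexive without changing which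
morphisms coequalize it. -/
lemma exists_coequalizer {T X : C} (a b : T ⟶ X) : ∃ (W : C) (c : X ⟶ W), IsRegularEpi c ∧
    a ≫ c = b ≫ c ∧ ∀ {Z : C} (g : X ⟶ Z), a ≫ g = b ≫ g → ∃ h : W ⟶ Z, c ≫ h = g := by
  obtain ⟨W, c, R, p₁, p₂, e, hc, hk, he, h₁, h₂⟩ := exists_coequalizer_of_reflexive
    (coprod.desc a (𝟙 X)) (coprod.desc b (𝟙 X)) coprod.inr
    (coprod.inr_desc _ _) (coprod.inr_desc _ _)
  refine ⟨W, c, hc, ?_, fun g hg => IsRegularEpi.exists_of_isKernelPair c hk g ?_⟩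
  · have ha : coprod.inl ≫ e ≫ p₁ = a := by rw [h₁, coprod.inl_desc]
    have hb : coprod.inl ≫ e ≫ p₂ = b := by rw [h₂, coprod.inl_desc]
    rw [← ha, ← hb]
    simp [hk.w]
  · rw [← cancel_epi e, reassoc_of% h₁, reassoc_of% h₂]
    refine coprod.hom_ext ?_ ?_
    · rw [coprod.inl_desc_assoc, coprod.inl_desc_assoc, hg]
    · rw [coprod.inr_desc_assoc, coprod.inr_desc_assoc]

end Relations

/-! ### Abelian objects as unital multiplications, and abelianization. -/

section Abelian

variable {C : Type u} [Category.{v} C] [HasZeroMorphisms C] [SemiAbelian C]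
  [CartesianMonoidalCategory C]

/-- The object `M` admits a multiplication with the zero morphism as a two-sided unit. -/
def HasUnitalMul (M : C) : Prop :=
  ∃ μ : M ⊗ M ⟶ M, lift (𝟙 M) 0 ≫ μ = 𝟙 M ∧ lift 0 (𝟙 M) ≫ μ = 𝟙 M

/-- An inversion for a unital multiplication. -/
lemma exists_inverse {M : C} (μ : M ⊗ M ⟶ M) (h₂ : lift 0 (𝟙 M) ≫ μ = 𝟙 M) :
    ∃ i : M ⟶ M, lift (𝟙 M) i ≫ μ = 0 := by
  have key {T : C} (t : T ⟶ M ⊗ M) (ht : t ≫ fst M M = 0) : t ≫ lift (fst M M) μ = t := by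
    have e : t = lift 0 (t ≫ snd M M) := by ext <;> simp [ht]
    ext
    · simp
    · rw [Category.assoc, lift_snd, e, lift_zero_left_comp, h₂, lift_snd, Category.comp_id]
  have : IsSplitEpi (lift (fst M M) μ ≫ fst M M) := ⟨⟨lift (𝟙 M) 0, by simp⟩⟩
  -- The shear `(x, y) ↦ (x, xy)` is the identity on the kernel of the first projection; its inverse
  -- at `(x, 0)` yields the inverse of `x`.
  have : IsIso (lift (fst M M) μ) := by
    refine isIso_of_kernel_lift (fst M M) _ (fun s t hs ht h => ?_) fun t ht => ⟨t, key t ht⟩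
    rw [lift_fst] at hs ht
    rwa [key s hs, key t ht] at h
  have e₁ : inv (lift (fst M M) μ) ≫ fst M M = fst M M := by simp [IsIso.inv_comp_eq]
  have e₂ : inv (lift (fst M M) μ) ≫ μ = snd M M := by simp [IsIso.inv_comp_eq]
  refine ⟨lift (𝟙 M) 0 ≫ inv (lift (fst M M) μ) ≫ snd M M, ?_⟩
  have e₃ : lift (𝟙 M) (lift (𝟙 M) 0 ≫ inv (lift (fst M M) μ) ≫ snd M M) =
      lift (𝟙 M) 0 ≫ inv (lift (fst M M) μ) := by ext <;> simp [e₁]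
  rw [e₃, Category.assoc, e₂, lift_snd]

lemma lift_swap_comp_of_unital {M : C} {μ : M ⊗ M ⟶ M} (h₁ : lift (𝟙 M) 0 ≫ μ = 𝟙 M)
    (h₂ : lift 0 (𝟙 M) ≫ μ = 𝟙 M) : lift (snd M M) (fst M M) ≫ μ = μ := by
  have e₁ : lift (𝟙 M) 0 ≫ lift (snd M M) (fst M M) = lift 0 (𝟙 M) := by ext <;> simp
  have e₂ : lift 0 (𝟙 M) ≫ lift (snd M M) (fst M M) = lift (𝟙 M) 0 := by ext <;> simp
  apply prod_hom_ext
  · rw [reassoc_of% e₁, h₁, h₂]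
  · rw [reassoc_of% e₂, h₁, h₂]

/-- Associativity and commutativity are equalities of morphisms on products, so unitality on the
axes forces them. -/
lemma exists_grpObj_of_hasUnitalMul [BraidedCategory C] {M : C} (h : HasUnitalMul M) :
    ∃ _ : GrpObj M, IsCommMonObj M := by
  obtain ⟨μ, h₁, h₂⟩ := h
  have a₁ {T : C} (x : T ⟶ M) : lift x 0 ≫ μ = x := by
    rw [lift_zero_right_comp, h₁, Category.comp_id]
  have a₂ {T : C} (x : T ⟶ M) : lift 0 x ≫ μ = x := by
    rw [lift_zero_left_comp, h₂, Category.comp_id]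
  have hc := lift_swap_comp_of_unital h₁ h₂
  obtain ⟨i, hi⟩ := exists_inverse μ h₂
  let _ : MonObj M :=
    { one := 0
      mul := μ
      one_mul := by
        have e : (0 : 𝟙_ C ⟶ M) ▷ M = lift 0 (snd (𝟙_ C) M) := by ext <;> simp
        rw [e, a₂, leftUnitor_hom]
      mul_one := by
        have e : M ◁ (0 : 𝟙_ C ⟶ M) = lift (fst M (𝟙_ C)) 0 := by ext <;> simp
        rw [e, a₁, rightUnitor_hom]
      mul_assoc := by
        apply prod_hom_ext
        · have e₁ : lift (𝟙 (M ⊗ M)) 0 ≫ μ ▷ M = lift μ 0 := by ext <;> simp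
          have e₂ : lift (𝟙 (M ⊗ M)) 0 ≫ (α_ M M M).hom = lift (fst M M) (lift (snd M M) 0) := by
            ext <;> simp
          rw [reassoc_of% e₁, reassoc_of% e₂, lift_whiskerLeft_assoc, a₁, a₁, lift_fst_snd,
            Category.id_comp]
        · have e₁ : lift 0 (𝟙 M) ≫ μ ▷ M = lift 0 (𝟙 M) := by ext <;> simp
          have e₂ : lift 0 (𝟙 M) ≫ (α_ M M M).hom = lift 0 (lift 0 (𝟙 M)) := by
            ext <;> simp
          rw [reassoc_of% e₁, reassoc_of% e₂, lift_whiskerLeft_assoc, a₂, a₂] }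
  let _ : GrpObj M :=
    { inv := i
      left_inv := by
        have e : lift i (𝟙 M) = lift (𝟙 M) i ≫ lift (snd M M) (fst M M) := by ext <;> simp
        change lift i (𝟙 M) ≫ μ = toUnit M ≫ 0
        rw [comp_zero, e, Category.assoc, hc, hi]
      right_inv := by
        change lift (𝟙 M) i ≫ μ = toUnit M ≫ 0
        rw [comp_zero, hi] }
  refine ⟨inferInstance, ⟨?_⟩⟩
  change (β_ M M).hom ≫ μ = μ
  have e : (β_ M M).hom = lift (snd M M) (fst M M) := by ext <;> simp
  rw [e, hc]

lemma hasUnitalMul_of_monObj {M : C} [MonObj M] : HasUnitalMul M := by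
  have hz : IsZero (𝟙_ C) := (isZero_zero C).of_iso
    (isTerminalTensorUnit.uniqueUpToIso (isZero_zero C).isTerminal)
  have h0 : (MonObj.one : 𝟙_ C ⟶ M) = 0 := hz.eq_of_src _ _
  have h₁ := MonObj.mul_one M
  have h₂ := MonObj.one_mul M
  have e₁ : lift (𝟙 M) 0 = (ρ_ M).inv ≫ M ◁ MonObj.one (X := M) := by
    ext
    · simp
    · rw [h0]; simp
  have e₂ : lift 0 (𝟙 M) = (λ_ M).inv ≫ MonObj.one (X := M) ▷ M := by
    ext
    · rw [h0]; simp
    · simp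
  refine ⟨MonObj.mul, ?_, ?_⟩
  · rw [e₁, Category.assoc, h₁, Iso.inv_hom_id]
  · rw [e₂, Category.assoc, h₂, Iso.inv_hom_id]

/-- Objects with a unital multiplication are closed under subobjects. -/
lemma HasUnitalMul.of_mono {M N : C} (m : M ⟶ N) [Mono m] (h : HasUnitalMul N) :
    HasUnitalMul M := by
  obtain ⟨μ, h₁, h₂⟩ := h
  have e₁ : lift (𝟙 M) 0 ≫ (m ⊗ₘ m) ≫ μ = m := by
    have : lift (𝟙 M) 0 ≫ (m ⊗ₘ m) = lift m 0 := by ext <;> simp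
    rw [reassoc_of% this, lift_zero_right_comp, h₁, Category.comp_id]
  have e₂ : lift 0 (𝟙 M) ≫ (m ⊗ₘ m) ≫ μ = m := by
    have : lift 0 (𝟙 M) ≫ (m ⊗ₘ m) = lift 0 m := by ext <;> simp
    rw [reassoc_of% this, lift_zero_left_comp, h₂, Category.comp_id]
  obtain ⟨ψ, hψ⟩ := exists_factor_of_prod ((m ⊗ₘ m) ≫ μ) m (𝟙 M) (𝟙 M)
    (by rw [e₁, Category.id_comp])
    (by rw [e₂, Category.id_comp])
  refine ⟨ψ, ?_, ?_⟩
  · rw [← cancel_mono m, Category.assoc, hψ, e₁, Category.id_comp]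
  · rw [← cancel_mono m, Category.assoc, hψ, e₂, Category.id_comp]

/-- If a regular epimorphism cooperates with itself, then its target has a unital
multiplication. -/
lemma hasUnitalMul_of_cooperator {X Z : C} (h : X ⟶ Z) [IsRegularEpi h] (q : X ⊗ X ⟶ Z)
    (h₁ : lift (𝟙 X) 0 ≫ q = h) (h₂ : lift 0 (𝟙 X) ≫ q = h) : HasUnitalMul Z := by
  obtain ⟨ψ, -, hψ₁, hψ₂⟩ := exists_descent h q (𝟙 Z) (by rw [h₁, Category.comp_id])
  have e₁ : lift (𝟙 X) 0 ≫ lift (snd X Z) (fst X Z) = lift 0 (𝟙 X) := by ext <;> simp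
  have e₂ : lift 0 (𝟙 Z) ≫ lift (snd X Z) (fst X Z) = lift (𝟙 Z) 0 := by ext <;> simp
  obtain ⟨χ, -, hχ₁, hχ₂⟩ := exists_descent h (lift (snd X Z) (fst X Z) ≫ ψ) (𝟙 Z)
    (by rw [Category.comp_id, reassoc_of% e₁, hψ₂, h₂])
  exact ⟨χ, hχ₁, by rw [hχ₂, reassoc_of% e₂, hψ₁]⟩

/-- The universal morphism to an object with a unital multiplication. -/
lemma exists_abelianization (X : C) : ∃ (Z : C) (h : X ⟶ Z), IsRegularEpi h ∧ HasUnitalMul Z ∧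
    ∀ {M : C}, HasUnitalMul M → ∀ g : X ⟶ M, ∃ k : Z ⟶ M, h ≫ k = g := by
  obtain ⟨Z, q, hq, hw, hu⟩ := exists_coequalizer (lift (𝟙 X) 0) (lift 0 (𝟙 X))
  -- Both axes have the same composite with `q`, so `q` factors through its image, which is
  -- therefore all of `Z`.
  have hh : IsRegularEpi (lift (𝟙 X) 0 ≫ q) := by
    obtain ⟨I, e, m, he, hm, hem⟩ := exists_image (lift (𝟙 X) 0 ≫ q)
    obtain ⟨ψ, hψ⟩ := exists_factor_of_prod q m e e hem (hem.trans hw)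
    subst hψ
    have := isRegularEpi_of_comp ψ m
    have : IsIso m := isIso_of_regularEpi_of_mono m (IsRegularEpi.getStruct m)
    rw [← hem]
    exact isRegularEpi_comp e m
  refine ⟨Z, lift (𝟙 X) 0 ≫ q, hh, ?_, fun {M} hM g => ?_⟩
  · exact hasUnitalMul_of_cooperator (lift (𝟙 X) 0 ≫ q) q rfl hw.symm
  · obtain ⟨μ, h₁, h₂⟩ := hM
    have e₁ : lift (𝟙 X) 0 ≫ (g ⊗ₘ g) ≫ μ = g := by
      have : lift (𝟙 X) 0 ≫ (g ⊗ₘ g) = lift g 0 := by ext <;> simp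
      rw [reassoc_of% this, lift_zero_right_comp, h₁, Category.comp_id]
    have e₂ : lift 0 (𝟙 X) ≫ (g ⊗ₘ g) ≫ μ = g := by
      have : lift 0 (𝟙 X) ≫ (g ⊗ₘ g) = lift 0 g := by ext <;> simp
      rw [reassoc_of% this, lift_zero_left_comp, h₂, Category.comp_id]
    obtain ⟨k, hk⟩ := hu ((g ⊗ₘ g) ≫ μ) (e₁.trans e₂.symm)
    exact ⟨k, by rw [Category.assoc, hk, e₁]⟩

end Abelian

/-! ### The reflection unit and perfect objects. -/

section Reflection

variable {C : Type u} [Category.{v} C] (P : ObjectProperty C) [Reflective P.ι]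

lemma exists_reflectionUnit_comp {A Z : C} (hZ : P Z) (g : A ⟶ Z) :
    ∃ k : P.ι.obj ((reflector P.ι).obj A) ⟶ Z, reflectionUnit P A ≫ k = g :=
  ⟨P.ι.map (((reflectorAdjunction P.ι).homEquiv A ⟨Z, hZ⟩).symm g),
    (Adjunction.homEquiv_unit _ _ _ _).symm.trans
      (((reflectorAdjunction P.ι).homEquiv A ⟨Z, hZ⟩).apply_symm_apply g)⟩

variable {P} in
lemma reflectionUnit_hom_ext {A Z : C} (hZ : P Z) {k l : P.ι.obj ((reflector P.ι).obj A) ⟶ Z}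
    (h : reflectionUnit P A ≫ k = reflectionUnit P A ≫ l) : k = l := by
  have := ((reflectorAdjunction P.ι).homEquiv A ⟨Z, hZ⟩).injective
    (a₁ := ObjectProperty.homMk k) (a₂ := ObjectProperty.homMk l)
    (by rw [Adjunction.homEquiv_unit, Adjunction.homEquiv_unit]; exact h)
  exact congrArg (fun t => t.hom) this

lemma reflectionUnit_naturality {A B : C} (f : B ⟶ A) :
    f ≫ reflectionUnit P A = reflectionUnit P B ≫ P.ι.map ((reflector P.ι).map f) :=
  (reflectorAdjunction P.ι).unit.naturality f

lemma prop_reflection (A : C) : P (P.ι.obj ((reflector P.ι).obj A)) :=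
  ((reflector P.ι).obj A).property

/-- Both projections factor through the unit, which is thus a split monomorphism into an object of
`P`. -/
lemma prop_tensor [P.IsClosedUnderSubobjects] [CartesianMonoidalCategory C] {X Y : C}
    (hX : P X) (hY : P Y) : P (X ⊗ Y) := by
  obtain ⟨k, hk⟩ := exists_reflectionUnit_comp P hX (fst X Y)
  obtain ⟨l, hl⟩ := exists_reflectionUnit_comp P hY (snd X Y)
  have : IsSplitMono (reflectionUnit P (X ⊗ Y)) := ⟨⟨lift k l, by ext <;> simp [hk, hl]⟩⟩
  exact P.prop_of_mono (reflectionUnit P (X ⊗ Y)) (prop_reflection P _)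

variable [HasZeroMorphisms C]

lemma isPerfect_of_reflectionUnit_eq_zero {A : C} (h : reflectionUnit P A = 0) :
    IsPerfect P A := by
  have h0 {Z : C} (hZ : P Z) (k : P.ι.obj ((reflector P.ι).obj A) ⟶ Z) : k = 0 :=
    reflectionUnit_hom_ext hZ (by rw [h, zero_comp, zero_comp])
  have hid := h0 (prop_reflection P A) (𝟙 _)
  have hz := (IsZero.iff_id_eq_zero _).2 hid
  refine ⟨fun Y => ⟨⟨⟨ObjectProperty.homMk 0⟩, fun k => ?_⟩⟩,
    fun Y => ⟨⟨⟨ObjectProperty.homMk 0⟩, fun k => ?_⟩⟩⟩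
  · exact P.ι.map_injective (hz.eq_of_src _ _)
  · exact P.ι.map_injective (hz.eq_of_tgt _ _)

lemma isZero_of_isPerfect {B W : C} (hB : IsPerfect P B) (hW : P W) (c : B ⟶ W)
    [IsRegularEpi c] : IsZero W := by
  have hepi : Epi c := (IsRegularEpi.getStruct c).epi
  refine IsZero.of_epi_eq_zero c ?_
  exact ((reflectorAdjunction P.ι).homEquiv B ⟨W, hW⟩).symm.injective (hB.eq_of_src _ _)

end Reflection

/-! ### Product projections as trivial extensions. -/

section Trivial

variable {C : Type u} [Category.{v} C] [HasZeroMorphisms C] [SemiAbelian C]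
  (P : ObjectProperty C) [Reflective P.ι] [P.IsClosedUnderSubobjects]

instance isRegularEpi_reflectionUnit (A : C) : IsRegularEpi (reflectionUnit P A) := by
  obtain ⟨I, e, m, he, hm, hem⟩ := exists_image (reflectionUnit P A)
  have hI : P I := P.prop_of_mono m (prop_reflection P A)
  obtain ⟨k, hk⟩ := exists_reflectionUnit_comp P hI e
  have hkm : k ≫ m = 𝟙 _ := reflectionUnit_hom_ext (prop_reflection P A)
    (by rw [reassoc_of% hk, hem, Category.comp_id])
  have : IsSplitEpi m := ⟨⟨k, hkm⟩⟩
  rw [← hem]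
  exact isRegularEpi_comp e m

variable [CartesianMonoidalCategory C]

/-- A product projection whose kernel lies in `P` is a trivial extension. -/
lemma isTrivialExtension_of_iso {A B K : C} (f : B ⟶ A) (hK : P K) (e : B ≅ A ⊗ K)
    (he : e.hom ≫ fst A K = f) : IsTrivialExtension P f := by
  have : IsSplitEpi (fst A K) := ⟨⟨lift (𝟙 A) 0, by simp⟩⟩
  have hf : IsRegularEpi f := by
    rw [← he]
    exact isRegularEpi_comp _ _
  refine ⟨hf, ?_⟩
  have hepi : Epi (reflectionUnit P A ▷ K) := (IsRegularEpi.getStruct _).epi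
  have hP := prop_tensor P (prop_reflection P A) hK
  obtain ⟨α, hα⟩ := exists_reflectionUnit_comp P hP (e.hom ≫ reflectionUnit P A ▷ K)
  obtain ⟨w, hw⟩ := exists_reflectionUnit_comp P (prop_reflection P B)
    (lift (𝟙 A) 0 ≫ e.inv ≫ reflectionUnit P B)
  -- Descending the unit of `B` along `η_A × K` identifies `I(B)` with `I(A) × K`.
  obtain ⟨β, hβ, -, -⟩ := exists_descent (reflectionUnit P A) (e.inv ≫ reflectionUnit P B) w hw
  let ε : P.ι.obj ((reflector P.ι).obj A) ⊗ K ≅ P.ι.obj ((reflector P.ι).obj B) :=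
    { hom := β
      inv := α
      hom_inv_id := by
        rw [← cancel_epi (reflectionUnit P A ▷ K), reassoc_of% hβ, hα, e.inv_hom_id_assoc,
          Category.comp_id]
      inv_hom_id := reflectionUnit_hom_ext (prop_reflection P B) (by
        rw [reassoc_of% hα, hβ, e.hom_inv_id_assoc, Category.comp_id]) }
  have hα' : α ≫ fst _ _ = P.ι.map ((reflector P.ι).map f) :=
    reflectionUnit_hom_ext (prop_reflection P A) (by
      rw [reassoc_of% hα, whiskerRight_fst, reassoc_of% he, reflectionUnit_naturality])
  refine (isPullback_whiskerRight (reflectionUnit P A) K).flip.of_iso e.symm (Iso.refl _) ε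
    (Iso.refl _) ?_ ?_ ?_ ?_
  · simp [← he]
  · simpa [ε] using hβ
  · simp
  · simp only [Iso.refl_hom, Category.comp_id]
    rw [← hα']
    exact (ε.hom_inv_id_assoc _).symm

end Trivial

/-! ### Centrality via cooperation of the kernel with the domain. -/

section Central

variable {C : Type u} [Category.{v} C] [HasZeroMorphisms C] [SemiAbelian C]

/-- If two regular quotients of `Q` have no common nonzero regular quotient, then the kernel of
one of them covers the other one. -/
lemma isRegularEpi_kernel_comp {Q B Y : C} (q : Q ⟶ B) (η : Q ⟶ Y) [IsRegularEpi q]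
    [IsRegularEpi η] [CartesianMonoidalCategory C]
    (h : ∀ {W : C} (c : B ⟶ W) (d : Y ⟶ W), IsRegularEpi c → IsRegularEpi d → IsZero W) :
    IsRegularEpi (kernel.ι η ≫ q) := by
  let s₁ := pullback.fst q q
  let s₂ := pullback.snd q q
  let t₁ := pullback.fst η η
  let t₂ := pullback.snd η η
  have hs : s₁ ≫ q = s₂ ≫ q := pullback.condition
  have ht : t₁ ≫ η = t₂ ≫ η := pullback.condition
  let δ := pullback.lift (f := q) (g := q) (𝟙 Q) (𝟙 Q) rfl
  have hδ₁ : δ ≫ s₁ = 𝟙 Q := pullback.lift_fst _ _ _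
  have hδ₂ : δ ≫ s₂ = 𝟙 Q := pullback.lift_snd _ _ _
  let ε := pullback.lift (f := η) (g := η) (𝟙 Q) (𝟙 Q) rfl
  have hε₁ : ε ≫ t₁ = 𝟙 Q := pullback.lift_fst _ _ _
  have hε₂ : ε ≫ t₂ = 𝟙 Q := pullback.lift_snd _ _ _
  let u₁ := pullback.fst s₂ t₁
  let u₂ := pullback.snd s₂ t₁
  have hu : u₁ ≫ s₂ = u₂ ≫ t₁ := pullback.condition
  obtain ⟨r, hr₁, hr₂⟩ : ∃ r, r ≫ u₁ = δ ∧ r ≫ u₂ = ε :=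
    ⟨pullback.lift δ ε (hδ₂.trans hε₁.symm), pullback.lift_fst _ _ _, pullback.lift_snd _ _ _⟩
  obtain ⟨i, hi₁, hi₂⟩ : ∃ i, i ≫ u₁ = 𝟙 _ ∧ i ≫ u₂ = s₂ ≫ ε :=
    ⟨pullback.lift (𝟙 _) (s₂ ≫ ε) (by simp [hε₁]), pullback.lift_fst _ _ _,
      pullback.lift_snd _ _ _⟩
  obtain ⟨j, hj₁, hj₂⟩ : ∃ j, j ≫ u₁ = t₁ ≫ δ ∧ j ≫ u₂ = 𝟙 _ :=
    ⟨pullback.lift (t₁ ≫ δ) (𝟙 _) (by simp [hδ₂]), pullback.lift_fst _ _ _,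
      pullback.lift_snd _ _ _⟩
  -- The pair sends a chain `x ~ y ~ z`, first modulo `q` and then modulo `η`, to its ends; its
  -- coequalizer is a quotient of both `B` and `Y`.
  obtain ⟨W, c, R, p₁, p₂, e, hc, hk, he, h₁, h₂⟩ := exists_coequalizer_of_reflexive
    (u₁ ≫ s₁) (u₂ ≫ t₂) r (by rw [reassoc_of% hr₁, hδ₁]) (by rw [reassoc_of% hr₂, hε₂])
  have huc : u₁ ≫ s₁ ≫ c = u₂ ≫ t₂ ≫ c := by
    rw [← reassoc_of% h₁, ← reassoc_of% h₂, hk.w]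
  obtain ⟨c₁, rfl⟩ := IsRegularEpi.exists_of_isKernelPair q (IsKernelPair.of_hasPullback q) c (by
    simpa [reassoc_of% hi₁, reassoc_of% hi₂, reassoc_of% hε₂] using i ≫= huc)
  obtain ⟨c₂, hc₂⟩ := IsRegularEpi.exists_of_isKernelPair η (IsKernelPair.of_hasPullback η)
    (q ≫ c₁) (by simpa [reassoc_of% hj₁, reassoc_of% hj₂, reassoc_of% hδ₁] using j ≫= huc)
  have hW : IsZero W := h c₁ c₂ (isRegularEpi_of_comp q c₁) (by
    rw [← hc₂] at hc
    exact isRegularEpi_of_comp η c₂)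
  -- As `W` is zero, `(x, 0)` lies in its kernel pair. Locally a chain `x ~ y ~ 0` covers it, giving
  -- `y` in `Ker η` with the same image in `B` as `x`.
  let l := hk.lift (𝟙 Q) 0 (hW.eq_of_tgt _ _)
  let v := pullback.snd l e
  have hv : pullback.fst l e ≫ l = v ≫ e := pullback.condition
  have hv₁ : v ≫ u₁ ≫ s₁ = pullback.fst l e := by
    rw [← h₁, ← reassoc_of% hv, hk.lift_fst, Category.comp_id]
  have hv₂ : v ≫ u₂ ≫ t₂ = 0 := by
    rw [← h₂, ← reassoc_of% hv, hk.lift_snd, comp_zero]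
  let z := kernel.lift η (v ≫ u₁ ≫ s₂) (by
    rw [hu, Category.assoc, Category.assoc, ht, ← Category.assoc u₂, ← Category.assoc, hv₂,
      zero_comp])
  have hz : z ≫ kernel.ι η ≫ q = pullback.fst l e ≫ q := by
    rw [kernel.lift_ι_assoc, ← hv₁]
    simp [hs]
  have : IsRegularEpi (z ≫ kernel.ι η ≫ q) := by
    rw [hz]
    exact isRegularEpi_comp _ _
  exact isRegularEpi_of_comp z _

lemma hasUnitalMul_kernel_of_cooperator [CartesianMonoidalCategory C] {A B : C} (f : B ⟶ A)
    (φ : B ⊗ kernel f ⟶ B) (h₁ : lift (𝟙 B) 0 ≫ φ = 𝟙 B)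
    (h₂ : lift 0 (𝟙 (kernel f)) ≫ φ = kernel.ι f) :
    HasUnitalMul (kernel f) := by
  have e₁ : lift (𝟙 (kernel f)) 0 ≫ kernel.ι f ▷ kernel f ≫ φ = kernel.ι f := by
    have : lift (𝟙 (kernel f)) 0 ≫ kernel.ι f ▷ kernel f = lift (kernel.ι f) 0 := by ext <;> simp
    rw [reassoc_of% this, lift_zero_right_comp, h₁, Category.comp_id]
  have e₂ : lift 0 (𝟙 (kernel f)) ≫ kernel.ι f ▷ kernel f ≫ φ = kernel.ι f := by
    have : lift 0 (𝟙 (kernel f)) ≫ kernel.ι f ▷ kernel f = lift 0 (𝟙 _) := by ext <;> simp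
    rw [reassoc_of% this, h₂]
  obtain ⟨ψ, hψ⟩ := exists_factor_of_prod (kernel.ι f ▷ kernel f ≫ φ) (kernel.ι f) (𝟙 _) (𝟙 _)
    (by rw [e₁, Category.id_comp]) (by rw [e₂, Category.id_comp])
  exact ⟨ψ, by rw [← cancel_mono (kernel.ι f), Category.assoc, hψ, e₁, Category.id_comp],
    by rw [← cancel_mono (kernel.ι f), Category.assoc, hψ, e₂, Category.id_comp]⟩

variable (P : ObjectProperty C) [Reflective P.ι]

/-- If `f` is a central extension with perfect domain `B`, then the kernel of `f` cooperates with
`B`. -/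
lemma exists_cooperator_of_isCentralExtension [IsBirkhoff P] [CartesianMonoidalCategory C]
    {A B : C} (f : B ⟶ A) (hf : IsCentralExtension P f) (hB : IsPerfect P B) :
    ∃ φ : B ⊗ kernel f ⟶ B, lift (𝟙 B) 0 ≫ φ = 𝟙 B ∧ lift 0 (𝟙 (kernel f)) ≫ φ = kernel.ι f := by
  obtain ⟨-, E, g, hg, -, hp⟩ := hf
  let p := pullback.snd f g
  let q := pullback.fst f g
  let η := reflectionUnit P (pullback f g)
  let k := pullback.lift (f := f) (g := g) (kernel.ι f) 0 (by simp)
  have hkq : k ≫ q = kernel.ι f := pullback.lift_fst _ _ _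
  have hkp : k ≫ p = 0 := pullback.lift_snd _ _ _
  have hpη : p ≫ reflectionUnit P E = η ≫ P.ι.map ((reflector P.ι).map p) :=
    reflectionUnit_naturality P p
  -- Both sides vanish, so `(n, x) ↦ (p(n), η(k(x)))` defines `σ` into the pullback.
  have w : (fst (kernel η) (kernel f) ≫ kernel.ι η ≫ p) ≫ reflectionUnit P E =
      (snd (kernel η) (kernel f) ≫ k ≫ η) ≫ P.ι.map ((reflector P.ι).map p) := by
    simp only [Category.assoc]
    rw [← hpη, reassoc_of% hkp, hpη, kernel.condition_assoc]
    simp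
  let σ := hp.lift _ _ w
  have hσ₁ : σ ≫ p = fst (kernel η) (kernel f) ≫ kernel.ι η ≫ p := hp.lift_fst _ _ w
  have hσ₂ : σ ≫ η = snd (kernel η) (kernel f) ≫ k ≫ η := hp.lift_snd _ _ w
  have e₁ : lift (𝟙 (kernel η)) 0 ≫ σ = kernel.ι η := by
    apply hp.hom_ext
    · change (_ ≫ σ) ≫ p = _ ≫ p
      simp [hσ₁]
    · change (_ ≫ σ) ≫ η = _ ≫ η
      simp [hσ₂]
  have e₂ : lift 0 (𝟙 (kernel f)) ≫ σ = k := by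
    apply hp.hom_ext
    · change (_ ≫ σ) ≫ p = _ ≫ p
      simp [hσ₁, hkp]
    · change (_ ≫ σ) ≫ η = _ ≫ η
      simp [hσ₂]
  have : IsRegularEpi (kernel.ι η ≫ q) := isRegularEpi_kernel_comp q η fun c d hc hd =>
    isZero_of_isPerfect P hB (IsBirkhoff.prop_of_isRegularEpi d hd (prop_reflection P _)) c
  obtain ⟨φ, -, hφ₁, hφ₂⟩ := exists_descent (kernel.ι η ≫ q) (σ ≫ q) (𝟙 B)
    (by rw [reassoc_of% e₁, Category.comp_id])
  exact ⟨φ, hφ₁, by rw [hφ₂, reassoc_of% e₂, hkq]⟩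

variable [P.IsClosedUnderSubobjects] [CartesianMonoidalCategory C]

/-- An extension whose kernel lies in `P` and cooperates with the domain is central. -/
lemma isCentralExtension_of_cooperator {A B : C} (f : B ⟶ A) (hf : IsRegularEpi f)
    (hK : P (kernel f)) (φ : B ⊗ kernel f ⟶ B) (h₁ : lift (𝟙 B) 0 ≫ φ = 𝟙 B)
    (h₂ : lift 0 (𝟙 (kernel f)) ≫ φ = kernel.ι f) : IsCentralExtension P f := by
  refine ⟨hf, B, f, hf, ?_⟩
  have hφ : φ ≫ f = fst _ _ ≫ f := by
    apply prod_hom_ext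
    · rw [reassoc_of% h₁, lift_fst_assoc, Category.id_comp]
    · rw [reassoc_of% h₂, lift_fst_assoc, kernel.condition, zero_comp]
  let b : B ⊗ kernel f ⟶ pullback f f := pullback.lift φ (fst _ _) hφ
  have hb₁ : b ≫ pullback.fst f f = φ := pullback.lift_fst _ _ _
  have hb₂ : b ≫ pullback.snd f f = fst _ _ := pullback.lift_snd _ _ _
  have key {T : C} (s : T ⟶ B ⊗ kernel f) (hs : s ≫ fst _ _ = 0) :
      s ≫ φ = s ≫ snd _ _ ≫ kernel.ι f := by
    have e : s = lift 0 (s ≫ snd _ _) := by ext <;> simp [hs]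
    rw [e, lift_zero_left_comp, h₂]
    simp
  have : IsSplitEpi (b ≫ pullback.snd f f) := by
    rw [hb₂]
    exact ⟨⟨lift (𝟙 B) 0, by simp⟩⟩
  have : IsIso b := by
    refine isIso_of_kernel_lift (pullback.snd f f) b (fun s t hs ht h => ?_) fun t ht => ?_
    · rw [hb₂] at hs ht
      have := h =≫ pullback.fst f f
      rw [Category.assoc, Category.assoc, hb₁, key s hs, key t ht, ← Category.assoc,
        ← Category.assoc, cancel_mono] at this
      refine CartesianMonoidalCategory.hom_ext _ _ ?_ ?_
      · rw [hs, ht]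
      · exact this
    · have h : (t ≫ pullback.fst f f) ≫ f = 0 := by
        rw [Category.assoc, pullback.condition, reassoc_of% ht, zero_comp]
      refine ⟨lift 0 (kernel.lift f _ h), ?_⟩
      apply pullback.hom_ext
      · rw [Category.assoc, hb₁, key _ (by simp)]
        simp
      · rw [Category.assoc, hb₂, ht, lift_fst]
  exact isTrivialExtension_of_iso P _ hK (asIso b).symm (by simp [hb₂])

/-- The domain of a universal central extension is perfect. -/
lemma isPerfect_of_isUniversalCentralExtension {U A : C} (u : U ⟶ A)
    (hu : IsUniversalCentralExtension P u) : IsPerfect P U := by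
  let K := P.ι.obj ((reflector P.ι).obj U)
  have : IsSplitEpi (fst A K) := ⟨⟨lift (𝟙 A) 0, by simp⟩⟩
  have hc : IsCentralExtension P (fst A K) :=
    ⟨inferInstance, A, 𝟙 A, inferInstance, isTrivialExtension_of_iso P _ (prop_reflection P U)
      (asIso (pullback.fst (fst A K) (𝟙 A))) (by simp [pullback.condition, K])⟩
  -- Two lifts of `u` to the central extension `A × I(U) ⟶ A` must agree, so the unit at `U` is
  -- zero.
  have h := (hu.2 _ _ hc).unique (y₁ := lift u (reflectionUnit P U)) (y₂ := lift u 0)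
    (lift_fst _ _) (lift_fst _ _)
  refine isPerfect_of_reflectionUnit_eq_zero P ?_
  simpa using h =≫ snd _ _

end Central

/-! ### The subcategory `Ab(C)` is reflective and closed under subobjects. -/

section AbelianObjects

variable (C : Type u) [Category.{v} C] [HasZeroMorphisms C] [SemiAbelian C]

lemma abelianObjects_iff (M : C) :
    letI : CartesianMonoidalCategory C := CartesianMonoidalCategory.ofHasFiniteProducts
    abelianObjects C M ↔ HasUnitalMul M := by
  let _ : CartesianMonoidalCategory C := CartesianMonoidalCategory.ofHasFiniteProducts
  let _ : BraidedCategory C := BraidedCategory.ofCartesianMonoidalCategory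
  exact ⟨fun ⟨_, _⟩ => hasUnitalMul_of_monObj, fun h => exists_grpObj_of_hasUnitalMul h⟩

instance isClosedUnderSubobjects_abelianObjects :
    (abelianObjects C).IsClosedUnderSubobjects where
  prop_of_mono m _ h := by
    let _ : CartesianMonoidalCategory C := CartesianMonoidalCategory.ofHasFiniteProducts
    exact (abelianObjects_iff C _).2 (((abelianObjects_iff C _).1 h).of_mono m)

lemma nonempty_reflective_abelianObjects : Nonempty (Reflective (abelianObjects C).ι) := by
  let _ : CartesianMonoidalCategory C := CartesianMonoidalCategory.ofHasFiniteProducts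
  choose Z h hh hZ hd using fun X : C => exists_abelianization X
  have hepi (X : C) : Epi (h X) := (hh X).getStruct.epi
  let F (X : C) : (abelianObjects C).FullSubcategory := ⟨Z X, (abelianObjects_iff C _).2 (hZ X)⟩
  let e (X : C) (Y : (abelianObjects C).FullSubcategory) :
      (F X ⟶ Y) ≃ (X ⟶ (abelianObjects C).ι.obj Y) :=
    Equiv.ofBijective (fun k => h X ≫ (abelianObjects C).ι.map k)
      ⟨fun k l hkl => (abelianObjects C).ι.map_injective ((cancel_epi (h X)).1 hkl), fun g => by
        obtain ⟨k, hk⟩ := hd X ((abelianObjects_iff C _).1 Y.property) g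
        exact ⟨ObjectProperty.homMk k, hk⟩⟩
  exact ⟨{ L := Adjunction.leftAdjointOfEquiv e (by intros; simp [e])
           adj := Adjunction.adjunctionOfEquivLeft e (by intros; simp [e]) }⟩

end AbelianObjects

lemma isCentralExtension_abelianObjects {C : Type u} [Category.{v} C] [HasZeroMorphisms C]
    [SemiAbelian C] (P : ObjectProperty C) [Reflective P.ι] [IsBirkhoff P]
    [Reflective (abelianObjects C).ι] {B A : C} (f : B ⟶ A) (hf : IsCentralExtension P f)
    (hB : IsPerfect P B) : IsCentralExtension (abelianObjects C) f := by
  let _ : CartesianMonoidalCategory C := CartesianMonoidalCategory.ofHasFiniteProducts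
  obtain ⟨φ, h₁, h₂⟩ := exists_cooperator_of_isCentralExtension P f hf hB
  exact isCentralExtension_of_cooperator _ f hf.1
    ((abelianObjects_iff C _).2 (hasUnitalMul_kernel_of_cooperator f φ h₁ h₂)) φ h₁ h₂

end SemiAb

theorem mainTheorem7 {C : Type u} [Category.{v} C] [HasZeroMorphisms C]
    [SemiAb.SemiAbelian C] (P : ObjectProperty C) [Reflective P.ι] [SemiAb.IsBirkhoff P] :
    Nonempty (Reflective (SemiAb.abelianObjects C).ι) ∧
      ∀ [Reflective (SemiAb.abelianObjects C).ι],
        (∀ {B A : C} (f : B ⟶ A), SemiAb.IsCentralExtension P f → SemiAb.IsPerfect P B →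
          SemiAb.IsCentralExtension (SemiAb.abelianObjects C) f) ∧
        (∀ {U A : C} (u : U ⟶ A), SemiAb.IsUniversalCentralExtension P u →
          SemiAb.IsCentralExtension (SemiAb.abelianObjects C) u) := by
  refine ⟨SemiAb.nonempty_reflective_abelianObjects C,
    fun f hf hB => SemiAb.isCentralExtension_abelianObjects P f hf hB, fun u hu => ?_⟩
  let _ : CartesianMonoidalCategory C := CartesianMonoidalCategory.ofHasFiniteProducts
  exact SemiAb.isCentralExtension_abelianObjects P u hu.1
    (SemiAb.isPerfect_of_isUniversalCentralExtension P u hu)
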